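/- Let $G\subset O(n)$ be a finite reflection group, i.e. a finite group of orthogonal $n\times n$ matrices generated by reflections (elements whose space of fixed vectors is a hyperplane), acting on $\mathbb{R}[X]=\mathbb{R}[X_1,\ldots,X_n]$ by $f^g=f\circ g^{-1}$. Let $\pi_1,\ldots,\pi_n$ be algebraically independent polynomials with $\mathbb{R}[X]^G=\mathbb{R}[\pi_1,\ldots,\pi_n]$, let $\mathcal{R}_G(f)=\frac{1}{|G|}\sum_{g\in G}f^g$ be the Reynolds operator, and let $\mathbb{R}[X]_G=\mathbb{R}[X]/I$ be the covariant algebra, where $I$ is the ideal generated by the invariant polynomials without constant term. Let $\mathbb{R}[X]_G=\bigoplus_{j=1}^{l}\eta_j\,\theta_j$ be a decomposition of the covariant algebra into irreducible real representations, where $\theta_1,\ldots,\theta_l$ are pairwise non-isomorphic and $\eta_j$ is the multiplicity of $\theta_j$, which for a finite reflection group equals $\dim\theta_j$. Let the decomposition be realised by homogeneous polynomials: that is, for $1\le j\le l$ and $1\le u\le\eta_j$ let $\varphi_{j,u}:\theta_j\to\mathbb{R}[X]$ be $G$-equivariant linear maps, the image of each consisting of homogeneous polynomials of one degree, such that the map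 $\bigoplus_{j}\theta_j^{\eta_j}\to\mathbb{R}[X]_G$, $(w_{j,u})\mapsto\sum_{j,u}\varphi_{j,u}(w_{j,u})+I$, is bijective. Choose a nonzero vector $v_j\in\theta_j$ for each $j$, put $s_{j,u}=\varphi_{j,u}(v_j)$, and let $$H^{\theta_j}=\bigl(\mathcal{R}_G(s_{j,u}\,s_{j,v})\bigr)_{1\le u,v\le\eta_j}\in\mathbb{R}[\pi_1,\ldots,\pi_n]^{\eta_j\times\eta_j}.$$ **Theorem.** The $G$-invariant polynomials that are sums of squares in $\mathbb{R}[X]$ are exactly the $g\in\mathbb{R}[\pi_1,\ldots,\pi_n]$ that can be written as $$g=\sum_{j=1}^{l}\operatorname{Tr}\bigl(H^{\theta_j}A_j\bigr),$$ where each $A_j\in\mathbb{R}[\pi_1,\ldots,\pi_n]^{\eta_j\times\eta_j}$ is a sum of squares matrix polynomial, i.e. $A_j=L_j^{T}L_j$ for some (not necessarily square) matrix $L_j$ with entries in $\mathbb{R}[\pi_1,\ldots,\pi_n]$. -/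

import Mathlib

open MvPolynomial

noncomputable section

namespace InvariantSOS

variable {n : ℕ}

/-- The action of an orthogonal matrix `g` on polynomial functions, `f ↦ f ∘ g⁻¹`, as an algebra
homomorphism: the variable `X i` is sent to the `i`-th coordinate of `g⁻¹ X`. -/
def act (g : Matrix.orthogonalGroup (Fin n) ℝ) :
    MvPolynomial (Fin n) ℝ →ₐ[ℝ] MvPolynomial (Fin n) ℝ :=
  aeval (fun i => ∑ j, C ((g⁻¹).1 i j) * X j)

theorem act_one : act (1 : Matrix.orthogonalGroup (Fin n) ℝ) = AlgHom.id ℝ _ := by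
  ext1 i
  simp [act, Matrix.one_apply]

theorem act_mul (g h : Matrix.orthogonalGroup (Fin n) ℝ) :
    act (g * h) = (act g).comp (act h) := by
  ext1 i
  simp only [act, aeval_X, AlgHom.comp_apply, map_sum, map_mul, algHom_C, algebraMap_eq,
    mul_inv_rev, Submonoid.coe_mul, Matrix.mul_apply, Finset.sum_mul, Finset.mul_sum]
  rw [Finset.sum_comm]
  simp only [mul_assoc]

/-- `g` is a reflection: its space of fixed vectors is a hyperplane of `ℝⁿ`. -/
def IsReflection (g : Matrix.orthogonalGroup (Fin n) ℝ) : Prop :=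
  Module.finrank ℝ (Module.End.eigenspace (Matrix.toLin' g.1) 1) + 1 = n

variable (G : Subgroup (Matrix.orthogonalGroup (Fin n) ℝ))

/-- `G` is generated by the reflections that it contains. -/
def IsReflectionGroup : Prop :=
  Subgroup.closure {g | g ∈ G ∧ IsReflection g} = G

/-- The linear representation of `G` on the polynomial ring. -/
def polyRep : Representation ℝ G (MvPolynomial (Fin n) ℝ) where
  toFun g := (act g.1).toLinearMap
  map_one' := by
    rw [OneMemClass.coe_one, act_one]
    rfl
  map_mul' g h := by
    rw [Subgroup.coe_mul, act_mul]
    rfl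

/-- The ring of `G`-invariant polynomials. -/
def invariantRing : Subalgebra ℝ (MvPolynomial (Fin n) ℝ) where
  carrier := {f | ∀ g ∈ G, act g f = f}
  mul_mem' ha hb g hg := by rw [map_mul, ha g hg, hb g hg]
  add_mem' ha hb g hg := by rw [map_add, ha g hg, hb g hg]
  algebraMap_mem' r g _ := (act g).commutes r

/-- The Reynolds operator `f ↦ |G|⁻¹ ∑ g, f ∘ g⁻¹`. -/
def reynolds [Fintype G] (f : MvPolynomial (Fin n) ℝ) : MvPolynomial (Fin n) ℝ :=
  (Fintype.card G : ℝ)⁻¹ • ∑ g : G, act g.1 f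

/-- The ideal generated by the invariants without constant term. If `π₁, …, πₙ` are homogeneous
basic invariants, this is the ideal `(π₁, …, πₙ)`. -/
def covariantIdeal : Ideal (MvPolynomial (Fin n) ℝ) :=
  Ideal.span {f | f ∈ invariantRing G ∧ constantCoeff f = 0}

/-- The covariant algebra of `G`. -/
abbrev CovariantAlgebra : Type := MvPolynomial (Fin n) ℝ ⧸ covariantIdeal G

/-- A decomposition of the covariant algebra into irreducible representations,
`ℝ[X]_G = ⨁ᵢ ηᵢ θᵢ`, realised by homogeneous polynomials. Here `ηᵢ` is both the multiplicity of
`θᵢ` and its dimension: for finite reflection groups the two agree, since the covariant algebra is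
the regular representation and every irreducible representation is realisable over `ℝ`.
The map `φ i j` embeds `θᵢ` equivariantly into the polynomial ring as the `j`-th copy of `θᵢ`,
and `v i` is a nonzero vector (hence a cyclic generator) of `θᵢ`. -/
structure CovariantDecomposition where
  /-- the number of isomorphism classes -/
  l : ℕ
  /-- the multiplicities, which are also the dimensions -/
  η : Fin l → ℕ
  /-- the irreducible representations -/
  θ : ∀ i, Representation ℝ G (Fin (η i) → ℝ)
  irreducible : ∀ i, (θ i).IsIrreducible
  not_iso : ∀ i i', i ≠ i' → IsEmpty ((θ i).Equiv (θ i'))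
  /-- the `j`-th copy of `θ i` -/
  φ : ∀ i, Fin (η i) → (θ i).IntertwiningMap (polyRep G)
  /-- the degree of the `j`-th copy of `θ i` -/
  deg : ∀ i, Fin (η i) → ℕ
  homogeneous : ∀ i j w, (φ i j w).IsHomogeneous (deg i j)
  /-- the chosen copies form a direct sum decomposition of the covariant algebra -/
  bijective : Function.Bijective
    (fun w : ∀ i, Fin (η i) → (Fin (η i) → ℝ) =>
      (Ideal.Quotient.mk (covariantIdeal G) (∑ i, ∑ j, φ i j (w i j)) : CovariantAlgebra G))
  /-- the chosen vector of `θ i` -/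
  v : ∀ i, Fin (η i) → ℝ
  v_ne_zero : ∀ i, v i ≠ 0

namespace CovariantDecomposition

variable {G} (D : CovariantDecomposition G)

/-- The polynomials `s_{i,1}, …, s_{i,ηᵢ}`, which correspond to each other under the
`G`-isomorphisms between the copies of `θᵢ`. -/
def s (i : Fin D.l) (j : Fin (D.η i)) : MvPolynomial (Fin n) ℝ :=
  D.φ i j (D.v i)

/-- The matrix `H^{θᵢ}` with entries `R_G(s_{i,u} s_{i,v})`. -/
def H [Fintype G] (i : Fin D.l) :
    Matrix (Fin (D.η i)) (Fin (D.η i)) (MvPolynomial (Fin n) ℝ) :=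
  Matrix.of fun u v => reynolds G (D.s i u * D.s i v)

end CovariantDecomposition

/-- `ℝ[π₁, …, πₙ]` as a subalgebra of the polynomial ring. -/
abbrev polyIn (π : Fin n → MvPolynomial (Fin n) ℝ) : Subalgebra ℝ (MvPolynomial (Fin n) ℝ) :=
  Algebra.adjoin ℝ (Set.range π)

/-- A matrix over `R` is a sum of squares matrix if it is `Lᵀ L` for some, possibly non-square,
matrix `L` over `R`. -/
def IsSosMatrix {R : Type*} [CommRing R] {k : ℕ} (A : Matrix (Fin k) (Fin k) R) : Prop :=
  ∃ (m : ℕ) (L : Matrix (Fin m) (Fin k) R), A = L.transpose * L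

end InvariantSOS

end

/-! The easy inclusion: Tr(H LᵀL) is the sum over the rows k of L of the averages of (∑ᵤ Lₖᵤ sᵤ)²,
and averaging preserves sums of squares (`trace_H_mul_transpose_mul`, `isSumSq_reynolds`).

For the other inclusion an invariant f = ∑ p² equals ∑ R(p²), so one square suffices. Graded
Nakayama gives p = ∑ r φ_{i,u}(e_b) with invariant coefficients r (`exists_eq_sum`). The
coefficients of R(φ_{i,u}(x) φ_{i',u'}(y)) are invariant bilinear forms in x and y. By Schur's lemma
they vanish for i ≠ i', and for i = i' they are multiples of the averaged inner product B of θᵢ, so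
the average is H_{u,u'} B(x,y)/B(v,v) (`averagedForm_mul_reynolds`). Since B is a sum of products of
linear forms, the matrix multiplying H factors as LᵀL.

Schur's lemma over ℝ needs θᵢ to have only scalar endomorphisms (`exists_eq_smul`). This is where
reflections and the equality of multiplicity and dimension enter: a non-scalar T would give ηᵢ + 1
equivariant maps from the ηᵢ-dimensional θᵢ, hence a relation over the invariants between their
values at v. Those values are independent modulo the covariant ideal, so Chevalley's argument
(`eq_zero_of_relation`) excludes such a relation. -/

noncomputable section

namespace InvariantSOS

/-! ### Chevalley's argument: independence over the invariant ring -/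

section Freeness

variable {n : ℕ}

theorem act_X (g : Matrix.orthogonalGroup (Fin n) ℝ) (i : Fin n) :
    act g (X i) = ∑ j, C ((g⁻¹).1 i j) * X j := by
  simp [act]

theorem isHomogeneous_act (g : Matrix.orthogonalGroup (Fin n) ℝ) {f : MvPolynomial (Fin n) ℝ}
    {d : ℕ} (hf : f.IsHomogeneous d) : (act g f).IsHomogeneous d := by
  have := hf.aeval (fun i => ∑ j, C ((g⁻¹).1 i j) * X j) (n := 1) (fun i =>
    IsHomogeneous.sum _ _ _ fun j _ => by
      simpa using (isHomogeneous_C (Fin n) ((g⁻¹).1 i j)).mul (isHomogeneous_X ℝ j))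
  simpa [act] using this

theorem homogeneousComponent_act (g : Matrix.orthogonalGroup (Fin n) ℝ)
    (f : MvPolynomial (Fin n) ℝ) (d : ℕ) :
    homogeneousComponent d (act g f) = act g (homogeneousComponent d f) := by
  conv_lhs => rw [← sum_homogeneousComponent f]
  simp only [map_sum]
  simp only [homogeneousComponent_of_mem
    (isHomogeneous_act g (homogeneousComponent_isHomogeneous _ f))]
  rw [Finset.sum_ite_eq]
  split_ifs with h
  · rfl
  · rw [homogeneousComponent_eq_zero _ _ (by simpa using h), map_zero]

theorem totalDegree_act_le (g : Matrix.orthogonalGroup (Fin n) ℝ) (f : MvPolynomial (Fin n) ℝ) :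
    (act g f).totalDegree ≤ f.totalDegree := by
  conv_lhs => rw [← sum_homogeneousComponent f, map_sum]
  refine totalDegree_finsetSum_le fun i hi => ?_
  exact (isHomogeneous_act g (homogeneousComponent_isHomogeneous i f)).totalDegree_le.trans
    (by simpa [Nat.lt_succ_iff] using hi)

theorem act_injective (g : Matrix.orthogonalGroup (Fin n) ℝ) : Function.Injective (act g) := by
  refine Function.LeftInverse.injective (g := act g⁻¹) fun f => ?_
  rw [← AlgHom.comp_apply, ← act_mul, inv_mul_cancel, act_one, AlgHom.id_apply]

/-- A reflection moves polynomials by multiples of the linear form of its hyperplane. -/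
theorem IsReflection.exists_dvd {g : Matrix.orthogonalGroup (Fin n) ℝ} (hg : IsReflection g) :
    ∃ l : MvPolynomial (Fin n) ℝ, l ≠ 0 ∧ l.IsHomogeneous 1 ∧ ∀ f, l ∣ act g f - f := by
  have hr : Module.finrank ℝ (LinearMap.range (Matrix.toLin' g.1 - 1)) = 1 := by
    have h := LinearMap.finrank_range_add_finrank_ker (Matrix.toLin' g.1 - 1)
    unfold IsReflection at hg
    rw [Module.End.eigenspace_def, one_smul] at hg
    rw [Module.finrank_fin_fun] at h
    omega
  obtain ⟨⟨v, hv⟩, hv0, hspan⟩ := finrank_eq_one_iff'.1 hr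
  have hv0' : v ≠ 0 := fun h => hv0 (by simpa using h)
  choose c hc using fun j : Fin n =>
    hspan ⟨(Matrix.toLin' g.1 - 1) (Pi.single j 1), LinearMap.mem_range_self _ _⟩
  -- As g - 1 has rank one, it is the outer product of a vector v spanning its range and a
  -- coefficient vector c.
  have hc' : ∀ i j, g.1 i j = c j * v i + (1 : Matrix (Fin n) (Fin n) ℝ) i j := by
    intro i j
    have := congrFun (congrArg Subtype.val (hc j)) i
    simp only [SetLike.val_smul, Pi.smul_apply, smul_eq_mul, LinearMap.sub_apply,
      Matrix.toLin'_apply, Module.End.one_apply, Pi.sub_apply, Matrix.mulVec_single_one,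
      Matrix.col_apply] at this
    rw [this, Matrix.one_apply, Pi.single_apply]
    ring
  set l : MvPolynomial (Fin n) ℝ := ∑ j, C (v j) * X j with hl
  have hX : ∀ i, act g (X i) = X i + C (c i) * l := by
    intro i
    have hinv : ∀ j, (g⁻¹).1 i j = g.1 j i := fun j => by
      rw [Matrix.UnitaryGroup.inv_val]
      simp [Matrix.star_apply]
    rw [act_X, hl, Finset.mul_sum]
    simp only [hinv, hc', map_add, map_mul, add_mul, Finset.sum_add_distrib, mul_assoc]
    rw [add_comm]
    congr 1
    rw [Finset.sum_eq_single i] <;> simp +contextual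
  refine ⟨l, ?_, ?_, fun f => ?_⟩
  · intro h0
    apply hv0'
    ext i
    have := congrArg (coeff (Finsupp.single i 1)) h0
    simpa [hl, coeff_sum, coeff_C_mul, coeff_X, Finsupp.single_left_inj] using this
  · exact IsHomogeneous.sum _ _ _ fun j _ => by
      simpa using (isHomogeneous_C (Fin n) (v j)).mul (isHomogeneous_X ℝ j)
  · rw [← Ideal.mem_span_singleton, ← Ideal.Quotient.mk_eq_mk_iff_sub_mem]
    -- Modulo l the action of g is trivial on the variables, hence on all polynomials.
    have : ((Ideal.Quotient.mkₐ ℝ (Ideal.span {l})).comp (act g)) =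
        Ideal.Quotient.mkₐ ℝ (Ideal.span {l}) := by
      ext i
      rw [AlgHom.comp_apply, hX]
      refine (Ideal.Quotient.mk_eq_mk_iff_sub_mem _ _).2 ?_
      rw [add_sub_cancel_left]
      exact Ideal.mul_mem_left _ _ (Ideal.mem_span_singleton_self l)
    exact DFunLike.congr_fun this f

variable (G : Subgroup (Matrix.orthogonalGroup (Fin n) ℝ))

theorem act_mem_covariantIdeal {g : Matrix.orthogonalGroup (Fin n) ℝ} (hg : g ∈ G)
    {f : MvPolynomial (Fin n) ℝ} (hf : f ∈ covariantIdeal G) : act g f ∈ covariantIdeal G := by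
  suffices covariantIdeal G ≤ (covariantIdeal G).comap (act g) from this hf
  refine Ideal.span_le.2 fun p hp => ?_
  rw [SetLike.mem_coe, Ideal.mem_comap, hp.1 g hg]
  exact Ideal.subset_span hp

theorem sub_C_mem_covariantIdeal {f : MvPolynomial (Fin n) ℝ} (hf : f ∈ invariantRing G) :
    f - C (constantCoeff f) ∈ covariantIdeal G :=
  Ideal.subset_span ⟨sub_mem hf ((invariantRing G).algebraMap_mem _), by simp⟩

variable [Fintype G]

/-- The Reynolds operator as a map of modules over the invariant ring. -/
def reynoldsLin : MvPolynomial (Fin n) ℝ →ₗ[invariantRing G] MvPolynomial (Fin n) ℝ where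
  toFun := reynolds G
  map_add' f h := by simp [reynolds, Finset.sum_add_distrib]
  map_smul' r f := by
    simp only [reynolds, RingHom.id_apply, Subalgebra.smul_def, smul_eq_mul, map_mul]
    rw [Finset.sum_congr rfl fun g _ => by rw [r.2 g.1 g.2], ← Finset.mul_sum, mul_smul_comm]

theorem reynoldsLin_apply (f : MvPolynomial (Fin n) ℝ) : reynoldsLin G f = reynolds G f := rfl

theorem reynolds_mul_left {r : MvPolynomial (Fin n) ℝ} (hr : r ∈ invariantRing G)
    (f : MvPolynomial (Fin n) ℝ) : reynolds G (r * f) = r * reynolds G f :=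
  (reynoldsLin G).map_smul ⟨r, hr⟩ f

theorem reynolds_mem (f : MvPolynomial (Fin n) ℝ) : reynolds G f ∈ invariantRing G := by
  intro g hg
  have h : ∑ h : G, act g (act h.1 f) = ∑ h : G, act h.1 f :=
    Fintype.sum_equiv (Equiv.mulLeft (⟨g, hg⟩ : G)) _ _ fun h => by simp [act_mul]
  rw [reynolds, map_smul, map_sum, h]

theorem reynolds_eq_self {f : MvPolynomial (Fin n) ℝ} (hf : f ∈ invariantRing G) :
    reynolds G f = f := by
  rw [reynolds, Finset.sum_congr rfl fun g _ => hf g.1 g.2, Finset.sum_const, Finset.card_univ,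
    ← Nat.cast_smul_eq_nsmul ℝ, smul_smul, inv_mul_cancel₀ (by simp), one_smul]

theorem reynolds_act {g : Matrix.orthogonalGroup (Fin n) ℝ} (hg : g ∈ G)
    (f : MvPolynomial (Fin n) ℝ) : reynolds G (act g f) = reynolds G f := by
  rw [reynolds, reynolds]
  congr 1
  refine Fintype.sum_equiv (Equiv.mulRight (⟨g, hg⟩ : G)) _ _ fun h => ?_
  simp [act_mul]

/-- A polynomial that is fixed by the reflections modulo the covariant ideal agrees with its
average modulo this ideal. -/
theorem sub_reynolds_mem_covariantIdeal (hG : IsReflectionGroup G) {f : MvPolynomial (Fin n) ℝ}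
    (hf : ∀ g ∈ G, IsReflection g → act g f - f ∈ covariantIdeal G) :
    f - reynolds G f ∈ covariantIdeal G := by
  -- The ideal is G-stable, so the elements fixing f modulo it form a subgroup.
  have key : ∀ g ∈ G, act g f - f ∈ covariantIdeal G := by
    intro g hg
    have hmem := hg
    rw [← hG] at hmem
    suffices g ∈ G ∧ act g f - f ∈ covariantIdeal G from this.2
    induction hmem using Subgroup.closure_induction with
    | mem x hx => exact ⟨hx.1, hf x hx.1 hx.2⟩
    | one => exact ⟨one_mem G, by simp [act_one]⟩
    | mul x y hx hy ihx ihy =>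
      rw [hG] at hx hy
      obtain ⟨hx, ihx⟩ := ihx hx
      obtain ⟨hy, ihy⟩ := ihy hy
      refine ⟨mul_mem hx hy, ?_⟩
      have := add_mem (act_mem_covariantIdeal G hx ihy) ihx
      rwa [map_sub, sub_add_sub_cancel, ← AlgHom.comp_apply, ← act_mul] at this
    | inv x hx ihx =>
      rw [hG] at hx
      obtain ⟨hx, ihx⟩ := ihx hx
      refine ⟨inv_mem hx, ?_⟩
      have := neg_mem (act_mem_covariantIdeal G (inv_mem hx) ihx)
      rwa [map_sub, ← AlgHom.comp_apply, ← act_mul, inv_mul_cancel, act_one, neg_sub,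
        AlgHom.id_apply] at this
  have h1 : f - reynolds G f = -((Fintype.card G : ℝ)⁻¹ • ∑ g : G, (act g.1 f - f)) := by
    rw [Finset.sum_sub_distrib, smul_sub, Finset.sum_const, Finset.card_univ,
      ← Nat.cast_smul_eq_nsmul ℝ, smul_smul, inv_mul_cancel₀ (by simp), one_smul, neg_sub]
    rfl
  rw [h1, smul_eq_C_mul]
  exact neg_mem (Ideal.mul_mem_left _ _ (sum_mem fun g _ => key g.1 g.2))

/-- Chevalley's lemma, localised at the origin: in a relation `f₀ h₀ + ∑ fᵢ hᵢ = 0` with invariant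
`fᵢ`, where `f₀` is not locally in the ideal of the invariant ring generated by the other `fᵢ`,
the polynomial `h₀` lies in the covariant ideal. -/
theorem mem_covariantIdeal_of_relation (hG : IsReflectionGroup G) {ι : Type*} [Fintype ι]
    {f₀ : MvPolynomial (Fin n) ℝ} {f : ι → MvPolynomial (Fin n) ℝ} (hf₀ : f₀ ∈ invariantRing G)
    (hf : ∀ i, f i ∈ invariantRing G)
    (hlocal : ∀ u ∈ invariantRing G, ∀ c : ι → MvPolynomial (Fin n) ℝ,
      (∀ i, c i ∈ invariantRing G) → u * f₀ = ∑ i, c i * f i → constantCoeff u = 0)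
    {h₀ : MvPolynomial (Fin n) ℝ} {h : ι → MvPolynomial (Fin n) ℝ}
    (hrel : f₀ * h₀ + ∑ i, f i * h i = 0) : h₀ ∈ covariantIdeal G := by
  induction hd : h₀.totalDegree using Nat.strong_induction_on generalizing h₀ h with
  | _ d ih =>
  have hsub : h₀ - reynolds G h₀ ∈ covariantIdeal G := by
    refine sub_reynolds_mem_covariantIdeal G hG fun s hs hrefl => ?_
    obtain ⟨l, hl0, hl1, hl⟩ := hrefl.exists_dvd
    obtain ⟨k₀, hk₀⟩ := hl h₀
    choose k hk using fun i => hl (h i)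
    -- Subtracting the relation from its reflected image leaves a multiple of l; cancelling l lowers
    -- the degree of the first cofactor and keeps the invariants f₀ and fᵢ.
    have hk_rel : f₀ * k₀ + ∑ i, f i * k i = 0 := by
      apply mul_left_cancel₀ hl0
      have hact := congrArg (act s) hrel
      simp only [map_add, map_mul, map_sum, map_zero, hf₀ s hs] at hact
      rw [Finset.sum_congr rfl fun i _ => by rw [hf i s hs]] at hact
      calc l * (f₀ * k₀ + ∑ i, f i * k i)
          = f₀ * (l * k₀) + ∑ i, f i * (l * k i) := by
            rw [mul_add, Finset.mul_sum]
            congr 1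
            · ring
            · exact Finset.sum_congr rfl fun i _ => by ring
        _ = (f₀ * act s h₀ + ∑ i, f i * act s (h i)) - (f₀ * h₀ + ∑ i, f i * h i) := by
            rw [← hk₀]
            simp only [← hk, mul_sub, Finset.sum_sub_distrib]
            ring
        _ = l * 0 := by rw [hact, hrel]; simp
    rw [hk₀]
    rcases eq_or_ne k₀ 0 with rfl | hk0
    · simp
    · refine Ideal.mul_mem_left _ _ (ih k₀.totalDegree ?_ hk_rel rfl)
      have h1 := totalDegree_mul_of_isDomain hl0 hk0
      rw [hl1.totalDegree hl0, ← hk₀] at h1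
      have h2 : (act s h₀ - h₀).totalDegree ≤ h₀.totalDegree :=
        (totalDegree_sub _ _).trans (max_le (totalDegree_act_le s h₀) le_rfl)
      omega
  -- Averaging the relation expresses R(h₀) f₀ through the other fᵢ with invariant coefficients.
  have hconst : constantCoeff (reynolds G h₀) = 0 := by
    refine hlocal _ (reynolds_mem G h₀) (fun i => -reynolds G (h i))
      (fun i => neg_mem (reynolds_mem G _)) ?_
    have := congrArg (reynoldsLin G) hrel
    simp only [map_add, map_sum, map_zero, reynoldsLin_apply, reynolds_mul_left G hf₀] at this
    rw [Finset.sum_congr rfl fun i _ => reynolds_mul_left G (hf i) (h i)] at this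
    simp only [neg_mul, Finset.sum_neg_distrib]
    rw [mul_comm, eq_neg_iff_add_eq_zero, ← this]
    simp only [mul_comm]
  have := add_mem hsub (Ideal.subset_span ⟨reynolds_mem G h₀, hconst⟩ :
    reynolds G h₀ ∈ covariantIdeal G)
  rwa [sub_add_cancel] at this

/-- In the second case u is a unit near the origin, so f₀ can be eliminated from the relation. -/
theorem mem_covariantIdeal_or_exists_of_relation (hG : IsReflectionGroup G) {ι : Type*}
    [Fintype ι]
    {f₀ : MvPolynomial (Fin n) ℝ} {f : ι → MvPolynomial (Fin n) ℝ} (hf₀ : f₀ ∈ invariantRing G)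
    (hf : ∀ i, f i ∈ invariantRing G)
    {h₀ : MvPolynomial (Fin n) ℝ} {h : ι → MvPolynomial (Fin n) ℝ}
    (hrel : f₀ * h₀ + ∑ i, f i * h i = 0) :
    h₀ ∈ covariantIdeal G ∨ ∃ u ∈ invariantRing G, ∃ c : ι → MvPolynomial (Fin n) ℝ,
      (∀ i, c i ∈ invariantRing G) ∧ u * f₀ = ∑ i, c i * f i ∧ constantCoeff u ≠ 0 := by
  by_contra! hcon
  exact hcon.1 (mem_covariantIdeal_of_relation G hG hf₀ hf hcon.2 hrel)

/-- Polynomials that are linearly independent modulo the covariant ideal are linearly independent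
over the invariant ring. -/
theorem eq_zero_of_relation (hG : IsReflectionGroup G) {m : ℕ}
    {h f : Fin m → MvPolynomial (Fin n) ℝ}
    (hh : ∀ c : Fin m → ℝ, ∑ i, C (c i) * h i ∈ covariantIdeal G → c = 0)
    (hf : ∀ i, f i ∈ invariantRing G) (hrel : ∑ i, f i * h i = 0) : f = 0 := by
  induction m with
  | zero => exact Subsingleton.elim _ _
  | succ m ih =>
  rw [Fin.sum_univ_succ] at hrel
  rcases mem_covariantIdeal_or_exists_of_relation G hG (hf 0)
      (f := fun i : Fin m => f i.succ) (h := fun i : Fin m => h i.succ)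
      (fun i => hf i.succ) hrel with
    hmem | ⟨u, hu, c, hc, huc, hu0⟩
  · have h1 : ∑ i, C ((Pi.single 0 1 : Fin (m + 1) → ℝ) i) * h i = h 0 := by
      rw [Fin.sum_univ_succ]
      simp
    have := congrFun (hh (Pi.single 0 1) (h1 ▸ hmem)) 0
    rw [Pi.single_eq_same] at this
    exact absurd this one_ne_zero
  · have hsucc : (fun i : Fin m => f i.succ) = 0 := by
      -- Multiplying the relation by u and substituting for u f₀ yields these m new cofactors.
      refine ih (h := fun i => u * h i.succ + c i * h 0) (fun a ha => ?_) (fun i => hf i.succ) ?_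
      · set U := constantCoeff u
        -- Modulo the ideal u and cᵢ reduce to their constant terms, so a dependence of the new
        -- cofactors becomes one of the hᵢ; U ≠ 0 then forces a = 0.
        have hb : ∑ i : Fin (m + 1), C ((Fin.cons (∑ i, a i * constantCoeff (c i))
            (fun i => a i * U) : Fin (m + 1) → ℝ) i) * h i ∈ covariantIdeal G := by
          have hdiff : ∑ i : Fin m, C (a i) * ((u - C U) * h i.succ +
              (c i - C (constantCoeff (c i))) * h 0) ∈ covariantIdeal G :=
            sum_mem fun i _ => Ideal.mul_mem_left _ _ (add_mem
              (Ideal.mul_mem_right _ _ (sub_C_mem_covariantIdeal G hu))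
              (Ideal.mul_mem_right _ _ (sub_C_mem_covariantIdeal G (hc i))))
          have := sub_mem ha hdiff
          rw [← Finset.sum_sub_distrib] at this
          rw [Fin.sum_univ_succ]
          simp only [Fin.cons_zero, Fin.cons_succ, map_sum, map_mul, Finset.sum_mul]
          rw [← Finset.sum_add_distrib]
          convert this using 2
          ring
        have h0 := hh _ hb
        ext i
        have := congrFun h0 i.succ
        simpa [hu0] using this
      · calc ∑ i : Fin m, f i.succ * (u * h i.succ + c i * h 0)
            = u * ∑ i : Fin m, f i.succ * h i.succ + (∑ i : Fin m, c i * f i.succ) * h 0 := by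
              rw [Finset.mul_sum, Finset.sum_mul, ← Finset.sum_add_distrib]
              exact Finset.sum_congr rfl fun i _ => by ring
          _ = u * (f 0 * h 0 + ∑ i : Fin m, f i.succ * h i.succ) := by
              rw [← huc]
              ring
          _ = 0 := by rw [hrel, mul_zero]
    have hzero : f 0 = 0 := by
      have h1 : u * f 0 = 0 := by
        rw [huc]
        exact Finset.sum_eq_zero fun i _ => by rw [congrFun hsucc i, Pi.zero_apply, mul_zero]
      refine (mul_eq_zero.1 h1).resolve_left ?_
      rintro rfl
      simp at hu0
    ext1 i
    refine Fin.cases hzero (fun j => congrFun hsucc j) i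

end Freeness

/-! ### Generation over the invariant ring, and invariant relations -/

section Generation

variable {n : ℕ} (G : Subgroup (Matrix.orthogonalGroup (Fin n) ℝ))

theorem homogeneousComponent_mem_invariantRing {f : MvPolynomial (Fin n) ℝ}
    (hf : f ∈ invariantRing G) (d : ℕ) : homogeneousComponent d f ∈ invariantRing G := fun g hg => by
  rw [← homogeneousComponent_act, hf g hg]

/-- In a multiple of a generator, the degree d part is a sum of products of a homogeneous invariant
of positive degree and a cofactor of degree below d, to which `hM` applies. -/
theorem homogeneousComponent_mem_of_mem_covariantIdeal
    {M : Submodule (invariantRing G) (MvPolynomial (Fin n) ℝ)} {d : ℕ}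
    (hM : ∀ e < d, ∀ q : MvPolynomial (Fin n) ℝ, q.IsHomogeneous e → q ∈ M)
    {p : MvPolynomial (Fin n) ℝ} (hp : p ∈ covariantIdeal G) : homogeneousComponent d p ∈ M := by
  -- Allowing a multiplier q makes the claim stable under multiplication by ring elements.
  suffices ∀ q, homogeneousComponent d (q * p) ∈ M by simpa using this 1
  induction hp using Submodule.span_induction with
  | zero => simp
  | add x y _ _ hx hy => intro q; rw [mul_add, map_add]; exact add_mem (hx q) (hy q)
  | smul a x _ hx => intro q; rw [smul_eq_mul, ← mul_assoc]; exact hx _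
  | mem x hx =>
    intro q
    rw [← sum_homogeneousComponent q, ← sum_homogeneousComponent x, Finset.sum_mul_sum]
    simp only [map_sum]
    refine sum_mem fun a _ => sum_mem fun b _ => ?_
    rw [homogeneousComponent_of_mem ((homogeneousComponent_isHomogeneous a q).mul
      (homogeneousComponent_isHomogeneous b x))]
    split_ifs with hab
    · rcases Nat.eq_zero_or_pos b with rfl | hb
      · have hx0 : coeff 0 x = 0 := hx.2
        simp [hx0]
      · rw [mul_comm]
        exact M.smul_mem ⟨_, homogeneousComponent_mem_invariantRing G hx.1 b⟩
          (hM a (by omega) _ (homogeneousComponent_isHomogeneous a q))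
    · exact zero_mem _

/-- Homogeneous polynomials that span the covariant algebra generate the polynomial ring as a module
over the invariant ring. -/
theorem exists_eq_sum_of_span {ι : Type*} [Fintype ι] {h : ι → MvPolynomial (Fin n) ℝ} {deg : ι → ℕ}
    (hdeg : ∀ i, (h i).IsHomogeneous (deg i))
    (hspan : ∀ f, ∃ c : ι → ℝ, f - ∑ i, C (c i) * h i ∈ covariantIdeal G)
    (f : MvPolynomial (Fin n) ℝ) :
    ∃ r : ι → MvPolynomial (Fin n) ℝ, (∀ i, r i ∈ invariantRing G) ∧ f = ∑ i, r i * h i := by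
  set M := Submodule.span (invariantRing G) (Set.range h)
  -- Graded Nakayama, by strong induction on the degree.
  have hhom : ∀ d, ∀ q : MvPolynomial (Fin n) ℝ, q.IsHomogeneous d → q ∈ M := by
    intro d
    induction d using Nat.strong_induction_on with
    | _ d ih =>
    intro q hq
    obtain ⟨c, hc⟩ := hspan q
    have h1 := homogeneousComponent_mem_of_mem_covariantIdeal G ih hc
    rw [map_sub, homogeneousComponent_eq_self hq, map_sum] at h1
    refine (Submodule.sub_mem_iff_left M (sum_mem fun i _ => ?_)).1 h1
    rw [homogeneousComponent_C_mul, homogeneousComponent_of_mem (hdeg i)]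
    split_ifs
    · exact M.smul_mem ⟨C (c i), (invariantRing G).algebraMap_mem _⟩
        (Submodule.subset_span ⟨i, rfl⟩)
    · simp
  have hf : f ∈ M := by
    rw [← sum_homogeneousComponent f]
    exact sum_mem fun d _ => hhom d _ (homogeneousComponent_isHomogeneous d f)
  obtain ⟨r, hr⟩ := (Submodule.mem_span_range_iff_exists_fun _).1 hf
  exact ⟨fun i => r i, fun i => (r i).2, hr.symm⟩

/-- A nonzero module of relations that is stable under the group contains a nonzero relation with
invariant coefficients. -/
theorem exists_invariant_relation [Fintype G] {ι : Type*} [Fintype ι]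
    (M : Submodule (MvPolynomial (Fin n) ℝ) (ι → MvPolynomial (Fin n) ℝ))
    (hM : ∀ g ∈ G, ∀ a ∈ M, (fun i => act g (a i)) ∈ M) (hne : M ≠ ⊥) :
    ∃ r ∈ M, (∀ i, r i ∈ invariantRing G) ∧ r ≠ 0 := by
  classical
  obtain ⟨a, ha, ha0⟩ := Submodule.exists_mem_ne_zero_of_ne_bot hne
  obtain ⟨i₀, hi₀⟩ := Function.ne_iff.1 ha0
  -- Multiplication by p turns the entry at i₀ into its norm, which is invariant and nonzero and so
  -- survives averaging.
  set p := ∏ g ∈ Finset.univ.erase (1 : G), act g.1 (a i₀) with hp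
  set r : ι → MvPolynomial (Fin n) ℝ := fun i => reynolds G (p * a i) with hr
  refine ⟨r, ?_, fun i => reynolds_mem G _, Function.ne_iff.2 ⟨i₀, ?_⟩⟩
  · have : r = (C (Fintype.card G : ℝ)⁻¹ : MvPolynomial (Fin n) ℝ) •
        ∑ g : G, (act g.1 p) • fun i => act g.1 (a i) := by
      ext1 i
      simp [hr, reynolds, Finset.sum_apply, smul_eq_C_mul]
    rw [this]
    exact M.smul_mem _ (sum_mem fun g _ => M.smul_mem _ (hM g.1 g.2 a ha))
  · have hprod : p * a i₀ = ∏ g : G, act g.1 (a i₀) := by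
      rw [← Finset.prod_erase_mul _ _ (Finset.mem_univ (1 : G)), hp]
      simp [act_one]
    have hinv : p * a i₀ ∈ invariantRing G := by
      intro g hg
      rw [hprod, map_prod]
      exact Fintype.prod_equiv (Equiv.mulLeft (⟨g, hg⟩ : G)) _ _ fun h => by simp [act_mul]
    have : r i₀ = p * a i₀ := reynolds_eq_self G hinv
    rw [this, hprod]
    exact Finset.prod_ne_zero_iff.2 fun g _ => (map_ne_zero_iff _ (act_injective g.1)).2 hi₀

theorem polyRep_apply (g : G) (f : MvPolynomial (Fin n) ℝ) : polyRep G g f = act g.1 f := rfl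

namespace CovariantDecomposition

variable {G} (D : CovariantDecomposition G)

theorem η_pos (i : Fin D.l) : 0 < D.η i := by
  by_contra h
  have : IsEmpty (Fin (D.η i)) := by
    rw [Nat.eq_zero_of_not_pos h]
    infer_instance
  exact D.v_ne_zero i (Subsingleton.elim _ _)

theorem eq_zero_of_mem_covariantIdeal {w : ∀ i, Fin (D.η i) → (Fin (D.η i) → ℝ)}
    (hw : ∑ i, ∑ j, D.φ i j (w i j) ∈ covariantIdeal G) : w = 0 := by
  apply D.bijective.1
  simpa using Ideal.Quotient.eq_zero_iff_mem.2 hw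

theorem eq_zero_of_mem_covariantIdeal_single (i : Fin D.l) {w : Fin (D.η i) → (Fin (D.η i) → ℝ)}
    (hw : ∑ j, D.φ i j (w j) ∈ covariantIdeal G) : w = 0 := by
  have := D.eq_zero_of_mem_covariantIdeal (w := Pi.single i w) (by
    rw [Finset.sum_eq_single i]
    · simpa using hw
    · intro i' _ hi'
      simp [Pi.single_eq_of_ne hi']
    · simp)
  simpa using congrFun this i

theorem exists_sub_mem_covariantIdeal (f : MvPolynomial (Fin n) ℝ) :
    ∃ w : ∀ i, Fin (D.η i) → (Fin (D.η i) → ℝ),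
      f - ∑ i, ∑ j, D.φ i j (w i j) ∈ covariantIdeal G := by
  obtain ⟨w, hw⟩ := D.bijective.2 (Ideal.Quotient.mk (covariantIdeal G) f)
  exact ⟨w, (Ideal.Quotient.mk_eq_mk_iff_sub_mem f _).1 hw.symm⟩

theorem φ_apply_eq_sum (i : Fin D.l) (j : Fin (D.η i)) (w : Fin (D.η i) → ℝ) :
    D.φ i j w = ∑ b, C (w b) * D.φ i j (Pi.single b 1) := by
  have h := congrArg (D.φ i j).toLinearMap (pi_eq_sum_univ' w)
  rw [map_sum] at h
  simp only [map_smul, smul_eq_C_mul] at h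
  exact h

/-- The polynomial ring is generated over the invariants by the images of the basis vectors. -/
theorem exists_eq_sum (f : MvPolynomial (Fin n) ℝ) :
    ∃ r : ∀ i, Fin (D.η i) → Fin (D.η i) → MvPolynomial (Fin n) ℝ,
      (∀ i j b, r i j b ∈ invariantRing G) ∧
      f = ∑ i, ∑ j, ∑ b, r i j b * D.φ i j (Pi.single b 1) := by
  set h : (Σ i : Fin D.l, Fin (D.η i) × Fin (D.η i)) → MvPolynomial (Fin n) ℝ :=
    fun x => D.φ x.1 x.2.1 (Pi.single x.2.2 1) with hh
  have hsum : ∀ r : (Σ i : Fin D.l, Fin (D.η i) × Fin (D.η i)) → MvPolynomial (Fin n) ℝ,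
      ∑ x, r x * h x = ∑ i, ∑ j, ∑ b, r ⟨i, j, b⟩ * D.φ i j (Pi.single b 1) := by
    intro r
    rw [Fintype.sum_sigma]
    exact Finset.sum_congr rfl fun i _ => Fintype.sum_prod_type _
  have hspan : ∀ f, ∃ c : (Σ i : Fin D.l, Fin (D.η i) × Fin (D.η i)) → ℝ,
      f - ∑ x, C (c x) * h x ∈ covariantIdeal G := by
    intro f
    obtain ⟨w, hw⟩ := D.exists_sub_mem_covariantIdeal f
    refine ⟨fun x => w x.1 x.2.1 x.2.2, ?_⟩
    have hs : ∑ i, ∑ j, D.φ i j (w i j) = ∑ x, C (w x.1 x.2.1 x.2.2) * h x :=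
      (Finset.sum_congr rfl fun i _ => Finset.sum_congr rfl fun j _ =>
        D.φ_apply_eq_sum i j _).trans (hsum fun x => C (w x.1 x.2.1 x.2.2)).symm
    exact hs ▸ hw
  obtain ⟨r, hr, hf⟩ := exists_eq_sum_of_span G (h := h) (deg := fun x => D.deg x.1 x.2.1)
    (fun x => D.homogeneous x.1 x.2.1 (Pi.single x.2.2 1)) hspan f
  exact ⟨fun i j b => r ⟨i, j, b⟩, fun i j b => hr _, hf.trans (hsum r)⟩

end CovariantDecomposition

end Generation

/-! ### Schur's lemma over the reals and invariant pairings -/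

section Schur

variable {n : ℕ} {G : Subgroup (Matrix.orthogonalGroup (Fin n) ℝ)} [Fintype G]

/-- More than `m` equivariant maps from an `m`-dimensional representation into the polynomial ring
are linearly dependent over the invariants. -/
theorem exists_invariant_relation_of_intertwiningMap {m : ℕ}
    {ρ : Representation ℝ G (Fin m → ℝ)} (ψ : Fin (m + 1) → ρ.IntertwiningMap (polyRep G)) :
    ∃ r : Fin (m + 1) → MvPolynomial (Fin n) ℝ, (∀ k, r k ∈ invariantRing G) ∧ r ≠ 0 ∧
      ∀ x, ∑ k, r k * ψ k x = 0 := by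
  set P : Matrix (Fin m) (Fin (m + 1)) (MvPolynomial (Fin n) ℝ) :=
    Matrix.of fun b k => ψ k (Pi.single b 1) with hP
  have hker : ∀ a, a ∈ LinearMap.ker P.mulVecLin ↔ ∀ x, ∑ k, a k * ψ k x = 0 := by
    intro a
    rw [LinearMap.mem_ker, Matrix.mulVecLin_apply]
    constructor
    · intro h x
      have hb : ∀ b, ∑ k, a k * ψ k (Pi.single b 1) = 0 := fun b => by
        simpa [hP, Matrix.mulVec, dotProduct, mul_comm] using congrFun h b
      have hx : ∀ k, ψ k x = ∑ b, C (x b) * ψ k (Pi.single b 1) := fun k => by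
        have h := congrArg (ψ k).toLinearMap (pi_eq_sum_univ' x)
        rw [map_sum] at h
        simp only [map_smul, smul_eq_C_mul] at h
        exact h
      simp only [hx, Finset.mul_sum]
      rw [Finset.sum_comm]
      refine Finset.sum_eq_zero fun b _ => ?_
      rw [← mul_zero (C (x b)), ← hb b, Finset.mul_sum]
      exact Finset.sum_congr rfl fun k _ => by ring
    · intro h
      ext1 b
      simpa [hP, Matrix.mulVec, dotProduct, mul_comm] using h (Pi.single b 1)
  have hstable : ∀ g ∈ G, ∀ a ∈ LinearMap.ker P.mulVecLin,
      (fun k => act g (a k)) ∈ LinearMap.ker P.mulVecLin := by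
    intro g hg a ha
    rw [hker] at ha ⊢
    intro x
    -- Equivariance moves g across ψ, so the relation is evaluated at ρ(g)⁻¹ x.
    have := congrArg (act g) (ha (ρ (⟨g, hg⟩ : G)⁻¹ x))
    rw [map_sum, map_zero] at this
    rw [← this]
    refine Finset.sum_congr rfl fun k _ => ?_
    rw [map_mul]
    congr 1
    have h1 := Representation.IntertwiningMap.isIntertwining _ _ (ψ k) (⟨g, hg⟩ : G)
      (ρ (⟨g, hg⟩ : G)⁻¹ x)
    rwa [Representation.self_inv_apply] at h1
  -- P has m rows and m + 1 columns, so it cannot be injective.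
  have hne : LinearMap.ker P.mulVecLin ≠ ⊥ := by
    intro hbot
    have := card_le_of_injective _ P.mulVecLin (LinearMap.ker_eq_bot.1 hbot)
    simp at this
  obtain ⟨r, hr, hinv, hr0⟩ := exists_invariant_relation G _ hstable hne
  exact ⟨r, hinv, hr0, (hker r).1 hr⟩

namespace CovariantDecomposition

variable (D : CovariantDecomposition G)

/-- The representations in the covariant algebra of a reflection group are absolutely irreducible:
their only equivariant endomorphisms are scalars. -/
theorem exists_eq_smul (hG : IsReflectionGroup G) (i : Fin D.l)
    (T : (D.θ i).IntertwiningMap (D.θ i)) : ∃ c : ℝ, ∀ w, T w = c • w := by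
  have := D.irreducible i
  by_contra! hT
  -- If v were an eigenvector, T - c would be non-injective, hence zero by irreducibility.
  have hprop : ∀ c : ℝ, T (D.v i) ≠ c • D.v i := by
    intro c hc
    obtain ⟨w, hw⟩ := hT c
    set S : (D.θ i).IntertwiningMap (D.θ i) :=
      (T.toLinearMap - c • LinearMap.id).intertwiningMap_of_isIntertwiningMap _ _ (by
        intro g x
        simp [T.isIntertwining]) with hS
    have hSapp : ∀ x, S x = T x - c • x := fun x => rfl
    rcases Representation.IsIrreducible.injective_or_eq_zero S with hinj | h0
    · refine D.v_ne_zero i (hinj ?_)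
      rw [hSapp, hSapp, hc]
      simp
    · refine hw (sub_eq_zero.1 ?_)
      rw [← hSapp, h0]
      rfl
  have j₀ : Fin (D.η i) := ⟨0, D.η_pos i⟩
  set ψ : Fin (D.η i + 1) → (D.θ i).IntertwiningMap (polyRep G) :=
    Fin.cons ((D.φ i j₀).comp T) (D.φ i) with hψ
  obtain ⟨r, hr, hr0, hrel⟩ := exists_invariant_relation_of_intertwiningMap ψ
  refine hr0 (eq_zero_of_relation G hG (h := fun k => ψ k (D.v i)) (fun c hc => ?_) hr
    (hrel (D.v i)))
  -- A dependence modulo the ideal is collected copy by copy; copy j₀ receives c_{j₀+1} v + c₀ T v,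
  -- and the others only multiples of v.
  have hw := D.eq_zero_of_mem_covariantIdeal_single i
    (w := fun j => c j.succ • D.v i + Pi.single (M := fun _ => Fin (D.η i) → ℝ) j₀
      (c 0 • T (D.v i)) j) (by
    convert hc using 1
    rw [Fin.sum_univ_succ]
    refine Eq.trans ?_ (add_comm _ _)
    simp only [hψ, Fin.cons_zero, Fin.cons_succ, map_add, map_smul, Finset.sum_add_distrib,
      smul_eq_C_mul]
    congr 1
    rw [Finset.sum_eq_single j₀]
    · rw [Pi.single_eq_same, map_smul, smul_eq_C_mul]
      rfl
    · intro j _ hj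
      rw [Pi.single_eq_of_ne hj, map_zero]
    · simp)
  have hc0 : c 0 = 0 := by
    by_contra h0
    refine hprop (-(c 0)⁻¹ * c j₀.succ) ?_
    have h1 := congrFun hw j₀
    simp only [Pi.single_eq_same, Pi.zero_apply] at h1
    have h2 := congrArg (fun x => (c 0)⁻¹ • x) (eq_neg_of_add_eq_zero_right h1)
    simp only [smul_smul, inv_mul_cancel₀ h0, one_smul, smul_neg] at h2
    rw [h2, ← neg_smul, neg_mul]
  ext1 k
  refine Fin.cases hc0 (fun j => ?_) k
  have h1 := congrFun hw j
  simp only [hc0, zero_smul, Pi.single_zero, Pi.zero_apply, add_zero] at h1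
  exact (smul_eq_zero.1 h1).resolve_right (D.v_ne_zero i)

end CovariantDecomposition

/-- The inner product on `ℝᵐ` that is obtained by averaging over the group. -/
def averagedForm {m : ℕ} (ρ : Representation ℝ G (Fin m → ℝ)) :
    LinearMap.BilinForm ℝ (Fin m → ℝ) :=
  ∑ g : G, (dotProductBilin ℝ ℝ).compl₁₂ (ρ g) (ρ g)

theorem averagedForm_apply {m : ℕ} (ρ : Representation ℝ G (Fin m → ℝ)) (x y : Fin m → ℝ) :
    averagedForm ρ x y = ∑ g : G, ∑ k, ρ g x k * ρ g y k := by
  simp [averagedForm, dotProduct]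

theorem averagedForm_map {m : ℕ} (ρ : Representation ℝ G (Fin m → ℝ)) (g : G)
    (x y : Fin m → ℝ) : averagedForm ρ (ρ g x) (ρ g y) = averagedForm ρ x y := by
  rw [averagedForm_apply, averagedForm_apply]
  exact Fintype.sum_equiv (Equiv.mulRight g) _ _ fun h => by simp

theorem averagedForm_self_pos {m : ℕ} (ρ : Representation ℝ G (Fin m → ℝ)) {x : Fin m → ℝ}
    (hx : x ≠ 0) : 0 < averagedForm ρ x x := by
  obtain ⟨k, hk⟩ := Function.ne_iff.1 hx
  rw [averagedForm_apply]
  refine Finset.sum_pos' (fun g _ => Finset.sum_nonneg fun k _ => mul_self_nonneg _)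
    ⟨1, Finset.mem_univ _, Finset.sum_pos' (fun k _ => mul_self_nonneg _)
      ⟨k, Finset.mem_univ _, ?_⟩⟩
  rw [map_one]
  exact mul_self_pos.2 hk

theorem averagedForm_nondegenerate {m : ℕ} (ρ : Representation ℝ G (Fin m → ℝ)) :
    (averagedForm ρ).Nondegenerate := by
  refine ⟨fun x hx => ?_, fun x hx => ?_⟩ <;>
  · by_contra h0
    exact (averagedForm_self_pos ρ h0).ne' (hx x)

/-- Every invariant pairing is represented by an equivariant map. -/
theorem exists_intertwiningMap_of_invariant {m m' : ℕ} (ρ : Representation ℝ G (Fin m → ℝ))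
    (σ : Representation ℝ G (Fin m' → ℝ)) (β : (Fin m → ℝ) →ₗ[ℝ] (Fin m' → ℝ) →ₗ[ℝ] ℝ)
    (hβ : ∀ g x y, β (ρ g x) (σ g y) = β x y) :
    ∃ T : ρ.IntertwiningMap σ, ∀ x y, β x y = averagedForm σ (T x) y := by
  set e := (averagedForm σ).toDual (averagedForm_nondegenerate σ)
  have he : ∀ x y, averagedForm σ (e.symm (β x)) y = β x y := fun x y => by
    have h := LinearMap.BilinForm.toDual_def (averagedForm_nondegenerate σ)
      (m := e.symm (β x)) (n := y)
    rw [← h]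
    change e (e.symm (β x)) y = _
    rw [LinearEquiv.apply_symm_apply]
  refine ⟨(e.symm.toLinearMap ∘ₗ β).intertwiningMap_of_isIntertwiningMap _ _ fun g x => ?_,
    fun x y => (he x y).symm⟩
  have h : ∀ y, e (e.symm (β (ρ g x))) y = e (σ g (e.symm (β x))) y := by
    intro y
    change averagedForm σ (e.symm (β (ρ g x))) y = averagedForm σ (σ g (e.symm (β x))) y
    obtain ⟨z, rfl⟩ : ∃ z, y = σ g z := ⟨σ g⁻¹ y, by simp⟩
    rw [he, hβ, averagedForm_map, he]
  exact e.injective (LinearMap.ext h)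

end Schur

/-! ### Averages of squares and sum of squares matrices -/

section SumsOfSquares

variable {n : ℕ} {G : Subgroup (Matrix.orthogonalGroup (Fin n) ℝ)} [Fintype G]

theorem IsSosMatrix.of_fintype {R : Type*} [CommRing R] {k : ℕ} {ι : Type*} [Fintype ι]
    (L : Matrix ι (Fin k) R) : IsSosMatrix (L.transpose * L) := by
  refine ⟨Fintype.card ι, L.submatrix (Fintype.equivFin ι).symm id, ?_⟩
  rw [Matrix.transpose_submatrix, Matrix.submatrix_mul_equiv, Matrix.submatrix_id_id]

theorem IsSosMatrix.zero {R : Type*} [CommRing R] {k : ℕ} :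
    IsSosMatrix (0 : Matrix (Fin k) (Fin k) R) :=
  ⟨0, 0, by simp⟩

theorem IsSosMatrix.add {R : Type*} [CommRing R] {k : ℕ} {A B : Matrix (Fin k) (Fin k) R}
    (hA : IsSosMatrix A) (hB : IsSosMatrix B) : IsSosMatrix (A + B) := by
  obtain ⟨a, L, rfl⟩ := hA
  obtain ⟨b, M, rfl⟩ := hB
  have := IsSosMatrix.of_fintype (Matrix.fromRows L M)
  rwa [Matrix.transpose_fromRows, Matrix.fromCols_mul_fromRows] at this

theorem isSumSq_act (g : Matrix.orthogonalGroup (Fin n) ℝ) {f : MvPolynomial (Fin n) ℝ}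
    (hf : IsSumSq f) : IsSumSq (act g f) := by
  induction hf with
  | zero => simp
  | sq_add a _ ih => simpa using ih.sq_add (act g a)

theorem isSumSq_reynolds {f : MvPolynomial (Fin n) ℝ} (hf : IsSumSq f) :
    IsSumSq (reynolds G f) := by
  have hc : C (Fintype.card G : ℝ)⁻¹ = (C (Real.sqrt (Fintype.card G : ℝ)⁻¹) *
      C (Real.sqrt (Fintype.card G : ℝ)⁻¹) : MvPolynomial (Fin n) ℝ) := by
    rw [← map_mul, Real.mul_self_sqrt (by positivity)]
  rw [reynolds, smul_eq_C_mul, hc]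
  exact (IsSumSq.mul_self _).mul (IsSumSq.sum fun g _ => isSumSq_act g.1 hf)

namespace CovariantDecomposition

variable (D : CovariantDecomposition G)

/-- The invariant pairing of two copies of irreducible representations, as the coefficients of the
averages of the products. -/
def coeffPairing (d : Fin n →₀ ℕ) {i i' : Fin D.l} (j : Fin (D.η i)) (j' : Fin (D.η i')) :
    (Fin (D.η i) → ℝ) →ₗ[ℝ] (Fin (D.η i') → ℝ) →ₗ[ℝ] ℝ :=
  (LinearMap.mul ℝ (MvPolynomial (Fin n) ℝ)).compr₂
    (lcoeff ℝ d ∘ₗ (reynoldsLin G).restrictScalars ℝ) |>.compl₁₂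
      (D.φ i j).toLinearMap (D.φ i' j').toLinearMap

theorem coeffPairing_apply (d : Fin n →₀ ℕ) {i i' : Fin D.l} (j : Fin (D.η i))
    (j' : Fin (D.η i')) (x : Fin (D.η i) → ℝ) (y : Fin (D.η i') → ℝ) :
    D.coeffPairing d j j' x y = coeff d (reynolds G (D.φ i j x * D.φ i' j' y)) := rfl

theorem coeffPairing_map (d : Fin n →₀ ℕ) {i i' : Fin D.l} (j : Fin (D.η i))
    (j' : Fin (D.η i')) (g : G) (x : Fin (D.η i) → ℝ) (y : Fin (D.η i') → ℝ) :
    D.coeffPairing d j j' (D.θ i g x) (D.θ i' g y) = D.coeffPairing d j j' x y := by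
  rw [coeffPairing_apply, coeffPairing_apply, Representation.IntertwiningMap.isIntertwining,
    Representation.IntertwiningMap.isIntertwining, polyRep_apply, polyRep_apply, ← map_mul,
    reynolds_act G g.2]

/-- Copies of non-isomorphic representations are orthogonal. -/
theorem reynolds_mul_eq_zero {i i' : Fin D.l} (hi : i ≠ i') (j : Fin (D.η i)) (j' : Fin (D.η i'))
    (x : Fin (D.η i) → ℝ) (y : Fin (D.η i') → ℝ) :
    reynolds G (D.φ i j x * D.φ i' j' y) = 0 := by
  ext d
  have := D.irreducible i
  have := D.irreducible i'
  have := D.not_iso i i' hi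
  -- Without an isomorphism between the irreducible representations, Schur's lemma leaves only T =
  -- 0.
  obtain ⟨T, hT⟩ := exists_intertwiningMap_of_invariant _ _ _ (D.coeffPairing_map d j j')
  rw [← coeffPairing_apply, hT, Subsingleton.elim T 0]
  simp

/-- The averages of the products of two copies of the same representation are given by its invariant
inner product and by the entry of the matrix `H`. -/
theorem averagedForm_mul_reynolds (hG : IsReflectionGroup G) (i : Fin D.l) (j j' : Fin (D.η i))
    (x y : Fin (D.η i) → ℝ) :
    C (averagedForm (D.θ i) (D.v i) (D.v i)) * reynolds G (D.φ i j x * D.φ i j' y) =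
      C (averagedForm (D.θ i) x y) * D.H i j j' := by
  ext d
  obtain ⟨T, hT⟩ := exists_intertwiningMap_of_invariant _ _ _ (D.coeffPairing_map d j j')
  obtain ⟨c, hc⟩ := D.exists_eq_smul hG i T
  have h : ∀ x y, coeff d (reynolds G (D.φ i j x * D.φ i j' y)) =
      c * averagedForm (D.θ i) x y := fun x y => by
    rw [← coeffPairing_apply, hT, hc, map_smul, LinearMap.smul_apply, smul_eq_mul]
  -- The scalar c depends on d; comparing with x = y = v eliminates it.
  rw [coeff_C_mul, coeff_C_mul, h, show D.H i j j' =
    reynolds G (D.φ i j (D.v i) * D.φ i j' (D.v i)) from rfl, h]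
  ring

theorem trace_H_mul (i : Fin D.l)
    (A : Matrix (Fin (D.η i)) (Fin (D.η i)) (invariantRing G)) :
    (D.H i * A.map (fun a => (a : MvPolynomial (Fin n) ℝ))).trace =
      ∑ u, ∑ u', D.H i u u' * (A u' u : MvPolynomial (Fin n) ℝ) := by
  simp [Matrix.trace, Matrix.mul_apply]

/-- The entries of L are invariant, so they pass through the Reynolds operator. -/
theorem trace_H_mul_transpose_mul (i : Fin D.l) {m : ℕ}
    (L : Matrix (Fin m) (Fin (D.η i)) (invariantRing G)) :
    (D.H i * (L.transpose * L).map (fun a => (a : MvPolynomial (Fin n) ℝ))).trace =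
      ∑ k, reynolds G ((∑ u, (L k u : MvPolynomial (Fin n) ℝ) * D.s i u) *
        ∑ u, (L k u : MvPolynomial (Fin n) ℝ) * D.s i u) := by
  have h : ∀ k, reynolds G ((∑ u, (L k u : MvPolynomial (Fin n) ℝ) * D.s i u) *
      ∑ u, (L k u : MvPolynomial (Fin n) ℝ) * D.s i u) =
      ∑ u, ∑ u', (L k u * L k u' : MvPolynomial (Fin n) ℝ) * D.H i u u' := by
    intro k
    rw [Finset.sum_mul_sum, ← reynoldsLin_apply, map_sum]
    refine Finset.sum_congr rfl fun u _ => ?_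
    rw [map_sum]
    refine Finset.sum_congr rfl fun u' _ => ?_
    rw [mul_mul_mul_comm, reynoldsLin_apply,
      reynolds_mul_left G (mul_mem (L k u).2 (L k u').2)]
    rfl
  simp only [h, trace_H_mul]
  refine Eq.symm (Finset.sum_comm.trans (Finset.sum_congr rfl fun u _ =>
    Finset.sum_comm.trans (Finset.sum_congr rfl fun u' _ => Eq.symm ?_)))
  rw [Matrix.mul_apply, AddSubmonoidClass.coe_finsetSum, Finset.mul_sum]
  refine Finset.sum_congr rfl fun k _ => ?_
  rw [MulMemClass.coe_mul, Matrix.transpose_apply]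
  ring

/-- The average of the square of a polynomial in one isotypic component. -/
theorem exists_isSosMatrix_reynolds_isotypic (hG : IsReflectionGroup G) (i : Fin D.l)
    {r : Fin (D.η i) → Fin (D.η i) → MvPolynomial (Fin n) ℝ}
    (hr : ∀ j b, r j b ∈ invariantRing G) :
    ∃ A : Matrix (Fin (D.η i)) (Fin (D.η i)) (invariantRing G), IsSosMatrix A ∧
      reynolds G ((∑ j, ∑ b, r j b * D.φ i j (Pi.single b 1)) *
        ∑ j, ∑ b, r j b * D.φ i j (Pi.single b 1)) =
      (D.H i * A.map (fun a => (a : MvPolynomial (Fin n) ℝ))).trace := by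
  set B := averagedForm (D.θ i) with hB
  set α := (B (D.v i) (D.v i))⁻¹ with hα
  have hpos : 0 < B (D.v i) (D.v i) := averagedForm_self_pos _ (D.v_ne_zero i)
  -- The rows follow the terms (ρ(g)x)ₖ (ρ(g)y)ₖ of the averaged form; √α absorbs the normalisation
  -- 1/B(v,v).
  let L : Matrix (G × Fin (D.η i)) (Fin (D.η i)) (invariantRing G) := Matrix.of fun x u =>
    ⟨∑ b, C (Real.sqrt α * D.θ i x.1 (Pi.single b 1) x.2) * r u b,
      sum_mem fun b _ => mul_mem ((invariantRing G).algebraMap_mem _) (hr u b)⟩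
  have hentry : ∀ u u', reynolds G ((∑ b, r u b * D.φ i u (Pi.single b 1)) *
      ∑ b, r u' b * D.φ i u' (Pi.single b 1)) =
      ∑ b, ∑ b', C (α * B (Pi.single b 1) (Pi.single b' 1)) * (r u b * r u' b') *
        D.H i u u' := by
    intro u u'
    rw [Finset.sum_mul_sum, ← reynoldsLin_apply, map_sum]
    refine Finset.sum_congr rfl fun b _ => ?_
    rw [map_sum]
    refine Finset.sum_congr rfl fun b' _ => ?_
    rw [mul_mul_mul_comm, reynoldsLin_apply, reynolds_mul_left G (mul_mem (hr u b) (hr u' b'))]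
    have hred : reynolds G (D.φ i u (Pi.single b 1) * D.φ i u' (Pi.single b' 1)) =
        C (α * B (Pi.single b 1) (Pi.single b' 1)) * D.H i u u' := by
      rw [map_mul, mul_assoc, ← D.averagedForm_mul_reynolds hG, ← mul_assoc, ← map_mul, hα,
        inv_mul_cancel₀ hpos.ne', map_one, one_mul]
    rw [hred]
    ring
  have hL : ∀ u u', ((L.transpose * L) u' u : MvPolynomial (Fin n) ℝ) =
      ∑ b, ∑ b', C (α * B (Pi.single b 1) (Pi.single b' 1)) * (r u b * r u' b') := by
    intro u u'
    rw [Matrix.mul_apply, AddSubmonoidClass.coe_finsetSum]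
    have hx : ∀ x, ((L.transpose u' x * L x u : invariantRing G) : MvPolynomial (Fin n) ℝ) =
        ∑ b, ∑ b', C (α * (D.θ i x.1 (Pi.single b 1) x.2 * D.θ i x.1 (Pi.single b' 1) x.2)) *
          (r u b * r u' b') := by
      intro x
      rw [mul_comm, MulMemClass.coe_mul, Matrix.transpose_apply]
      simp only [L, Matrix.of_apply]
      rw [Finset.sum_mul_sum]
      refine Finset.sum_congr rfl fun b _ => Finset.sum_congr rfl fun b' _ => ?_
      rw [mul_mul_mul_comm, ← map_mul, mul_mul_mul_comm, Real.mul_self_sqrt (by positivity)]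
    simp only [hx]
    rw [Finset.sum_comm]
    refine Finset.sum_congr rfl fun b _ => ?_
    rw [Finset.sum_comm]
    refine Finset.sum_congr rfl fun b' _ => ?_
    rw [← Finset.sum_mul, ← map_sum, ← Finset.mul_sum, hB, averagedForm_apply,
      Fintype.sum_prod_type]
  refine ⟨_, IsSosMatrix.of_fintype L, ?_⟩
  rw [trace_H_mul, Finset.sum_mul_sum, ← reynoldsLin_apply, map_sum]
  refine Finset.sum_congr rfl fun u _ => ?_
  rw [map_sum]
  refine Finset.sum_congr rfl fun u' _ => ?_
  rw [reynoldsLin_apply, hentry, hL, mul_comm, Finset.sum_mul]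
  exact Finset.sum_congr rfl fun b _ => (Finset.sum_mul _ _ _).symm

theorem reynolds_mul_isotypic_eq_zero {i i' : Fin D.l} (hi : i ≠ i')
    {r : ∀ i, Fin (D.η i) → Fin (D.η i) → MvPolynomial (Fin n) ℝ}
    (hr : ∀ i j b, r i j b ∈ invariantRing G) :
    reynolds G ((∑ j, ∑ b, r i j b * D.φ i j (Pi.single b 1)) *
      ∑ j, ∑ b, r i' j b * D.φ i' j (Pi.single b 1)) = 0 := by
  rw [← reynoldsLin_apply]
  simp only [Finset.sum_mul_sum, map_sum]
  refine Finset.sum_eq_zero fun j _ => Finset.sum_eq_zero fun j' _ =>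
    Finset.sum_eq_zero fun b _ => Finset.sum_eq_zero fun b' _ => ?_
  rw [mul_mul_mul_comm, reynoldsLin_apply,
    reynolds_mul_left G (mul_mem (hr i j b) (hr i' j' b')), D.reynolds_mul_eq_zero hi, mul_zero]

theorem exists_isSosMatrix_reynolds_mul_self (hG : IsReflectionGroup G)
    (p : MvPolynomial (Fin n) ℝ) :
    ∃ A : ∀ i : Fin D.l, Matrix (Fin (D.η i)) (Fin (D.η i)) (invariantRing G),
      (∀ i, IsSosMatrix (A i)) ∧ reynolds G (p * p) =
        ∑ i, (D.H i * (A i).map (fun a => (a : MvPolynomial (Fin n) ℝ))).trace := by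
  obtain ⟨r, hr, rfl⟩ := D.exists_eq_sum p
  choose A hA hAtr using fun i => D.exists_isSosMatrix_reynolds_isotypic hG i (hr i)
  refine ⟨A, hA, ?_⟩
  simp only [← hAtr]
  rw [Finset.sum_mul_sum, ← reynoldsLin_apply, map_sum]
  refine Finset.sum_congr rfl fun i _ => ?_
  rw [map_sum, Finset.sum_eq_single i]
  · rfl
  · intro i' _ hi'
    exact D.reynolds_mul_isotypic_eq_zero hi'.symm hr
  · simp

/-- The averages of sums of squares have a representation by sum of squares matrices. -/
theorem exists_isSosMatrix_reynolds (hG : IsReflectionGroup G) {f : MvPolynomial (Fin n) ℝ}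
    (hf : IsSumSq f) :
    ∃ A : ∀ i : Fin D.l, Matrix (Fin (D.η i)) (Fin (D.η i)) (invariantRing G),
      (∀ i, IsSosMatrix (A i)) ∧ reynolds G f =
        ∑ i, (D.H i * (A i).map (fun a => (a : MvPolynomial (Fin n) ℝ))).trace := by
  induction hf with
  | zero =>
    refine ⟨fun _ => 0, fun _ => IsSosMatrix.zero, ?_⟩
    rw [← reynoldsLin_apply, map_zero]
    simp
  | sq_add a _ ih =>
    obtain ⟨A, hA, hA'⟩ := ih
    obtain ⟨B, hB, hB'⟩ := D.exists_isSosMatrix_reynolds_mul_self hG a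
    refine ⟨fun i => B i + A i, fun i => (hB i).add (hA i), ?_⟩
    rw [← reynoldsLin_apply, map_add, reynoldsLin_apply, reynoldsLin_apply, hA', hB',
      ← Finset.sum_add_distrib]
    refine Finset.sum_congr rfl fun i _ => ?_
    simp [trace_H_mul, mul_add, Finset.sum_add_distrib]

/-- With S a variable, `hS` can be substituted, which identifies matrices over S with matrices over
the invariant ring. -/
theorem isSumSq_inter_eq (hG : IsReflectionGroup G) {S : Subalgebra ℝ (MvPolynomial (Fin n) ℝ)}
    (hS : invariantRing G = S) :
    {f : MvPolynomial (Fin n) ℝ | IsSumSq f} ∩ {f | f ∈ invariantRing G} =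
      {g | g ∈ S ∧ ∃ A : ∀ i : Fin D.l, Matrix (Fin (D.η i)) (Fin (D.η i)) S,
        (∀ i, IsSosMatrix (A i)) ∧
        g = ∑ i, (D.H i * (A i).map (fun a => (a : MvPolynomial (Fin n) ℝ))).trace} := by
  subst hS
  ext f
  constructor
  · rintro ⟨hf, hinv⟩
    obtain ⟨A, hA, hfA⟩ := D.exists_isSosMatrix_reynolds hG hf
    exact ⟨hinv, A, hA, (reynolds_eq_self G hinv).symm.trans hfA⟩
  · rintro ⟨hinv, A, hA, rfl⟩
    refine ⟨IsSumSq.sum fun i _ => ?_, hinv⟩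
    obtain ⟨m, L, hL⟩ := hA i
    rw [hL, trace_H_mul_transpose_mul]
    exact IsSumSq.sum fun k _ => isSumSq_reynolds (IsSumSq.mul_self _)

end CovariantDecomposition

end SumsOfSquares

end InvariantSOS

end

theorem mainTheorem5 {n : ℕ} (G : Subgroup (Matrix.orthogonalGroup (Fin n) ℝ)) [Fintype G]
    (hG : InvariantSOS.IsReflectionGroup G)
    (π : Fin n → MvPolynomial (Fin n) ℝ)
    (hind : AlgebraicIndependent ℝ π)
    (hπ : InvariantSOS.invariantRing G = InvariantSOS.polyIn π)
    (D : InvariantSOS.CovariantDecomposition G) :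
    {f : MvPolynomial (Fin n) ℝ | IsSumSq f} ∩ {f | f ∈ InvariantSOS.invariantRing G} =
      {g | g ∈ InvariantSOS.polyIn π ∧
        ∃ A : ∀ i : Fin D.l, Matrix (Fin (D.η i)) (Fin (D.η i)) (InvariantSOS.polyIn π),
          (∀ i, InvariantSOS.IsSosMatrix (A i)) ∧
          g = ∑ i, (D.H i * (A i).map (fun a => (a : MvPolynomial (Fin n) ℝ))).trace} :=
  D.isSumSq_inter_eq hG hπ
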